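/- Let $L^2=L^2(\mathbb R^3,\mathbb C)$, $H^2=H^2(\mathbb R^3,\mathbb C)$ and $W^{2,\infty}=W^{2,\infty}(\mathbb R^3,\mathbb R)$, and write $\langle f|\mu|g\rangle=\int_{\mathbb R^3}\overline{f(x)}\,\mu(x)g(x)\,dx$. Let $\mu\in W^{2,\infty}$, let $O$ be a bounded linear operator on $H^2$ that is positive and symmetric for the scalar product of $L^2$, and let $\alpha>0$, $T>0$ and $\delta,\eta\in(0,2)$. Then there is a constant $\lambda>0$, depending only on $\mu,O,\alpha,\delta,\eta$ and $T$, such that the following holds for every $V\in W^{2,\infty}$ and every $\psi_0\in H^2$ with $\|\psi_0\|_{L^2}=1$. Put $H=-\Delta+V$; solutions of the equations below are understood in $L^\infty(0,T;H^2)\cap W^{1,\infty}(0,T;L^2)$. Let $\varepsilon^0,\tilde\varepsilon^0\in L^\infty(0,T)$ be real-valued, and let the real-valued controls $\varepsilon^k,\tilde\varepsilon^k$ and the functions $\psi^k,\chi^k$ satisfy, for all $k\ge 0$, $$i\partial_t\psi^k=(H-\varepsilon^k(t)\mu)\psi^k,\quad \psi^k(0)=\psi_0,\qquad i\partial_t\chi^k=(H-\tilde\varepsilon^k(t)\mu)\chi^k,\quad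 \chi^k(T)=O\psi^k(T),$$ and, for all $k\ge 1$ and almost every $t\in(0,T)$, $$\varepsilon^k(t)=(1-\delta)\tilde\varepsilon^{k-1}(t)-\frac{\delta}{\alpha}\operatorname{Im}\langle\chi^{k-1}(t)|\mu|\psi^k(t)\rangle,\qquad \tilde\varepsilon^k(t)=(1-\eta)\varepsilon^k(t)-\frac{\eta}{\alpha}\operatorname{Im}\langle\chi^k(t)|\mu|\psi^k(t)\rangle.$$ For a control $\varepsilon$ denote by $\nabla J(\varepsilon)$ the function $t\mapsto-2\big(\alpha\varepsilon(t)+\operatorname{Im}\langle\chi(t)|\mu|\psi(t)\rangle\big)$, where $\psi$ and $\chi$ solve $i\partial_t\psi=(H-\varepsilon(t)\mu)\psi$, $\psi(0)=\psi_0$, and $i\partial_t\chi=(H-\varepsilon(t)\mu)\chi$, $\chi(T)=O\psi(T)$; this is the $L^2(0,T)$-gradient of $J(\varepsilon)=\langle\psi(T)|O|\psi(T)\rangle-\alpha\int_0^T\varepsilon(t)^2\,dt$. Then, for every $k\ge1$, $\nabla J(\varepsilon^k)\in L^1(0,T)$ and $$\|\nabla J(\varepsilon^k)\|_{L^1(0,T)}\le\lambda\Big(\|\varepsilon^k-\tilde\varepsilon^{k-1}\|_{L^2(0,T)}+\|\tilde\varepsilon^{k-1}-\varepsilon^{k-1}\|_{L^2(0,T)}\Big).$$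 -/

import Mathlib

open MeasureTheory TemperedDistribution
open scoped SchwartzMap Laplacian ENNReal ComplexConjugate ContDiff

noncomputable section

/-- The physical space `ℝ³`. -/
abbrev R3 : Type := EuclideanSpace ℝ (Fin 3)

/-- The Hilbert space `L²(ℝ³, ℂ)`. -/
abbrev L2 : Type := Lp ℂ 2 (volume : Measure R3)

/-- The Sobolev space `H²(ℝ³, ℂ)`, as a subspace of `L²(ℝ³, ℂ)`. -/
def H2 : Submodule ℂ L2 where
  carrier := {f | MemSobolev 2 2 (f : 𝓢'(R3, ℂ))}
  zero_mem' := by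
    change MemSobolev 2 2 ((0 : L2) : 𝓢'(R3, ℂ))
    rw [← Lp.toTemperedDistributionCLM_apply, map_zero]
    exact memSobolev_fun_zero R3 ℂ 2 2
  add_mem' := by
    intro f g hf hg
    change MemSobolev 2 2 ((f + g : L2) : 𝓢'(R3, ℂ))
    rw [← Lp.toTemperedDistributionCLM_apply, map_add]
    exact MemSobolev.add hf hg
  smul_mem' := by
    intro c f hf
    change MemSobolev 2 2 ((c • f : L2) : 𝓢'(R3, ℂ))
    rw [← Lp.toTemperedDistributionCLM_apply, map_smul]
    exact MemSobolev.smul c hf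

/-- The distributional Laplacian of an `H²` function is an `L²` function. -/
theorem H2.exists_laplacian (u : H2) :
    ∃ g : L2, Δ ((u : L2) : 𝓢'(R3, ℂ)) = (g : 𝓢'(R3, ℂ)) := by
  have h : MemSobolev 2 2 ((u : L2) : 𝓢'(R3, ℂ)) := u.2
  have h0 := h.laplacian
  rw [sub_self] at h0
  exact memSobolev_zero_iff.1 h0

/-- The Laplacian `H² → L²`. -/
def lap (u : H2) : L2 := (H2.exists_laplacian u).choose

theorem lap_spec (u : H2) : Δ ((u : L2) : 𝓢'(R3, ℂ)) = (lap u : 𝓢'(R3, ℂ)) :=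
  (H2.exists_laplacian u).choose_spec

/-- The norm of `H²`: `‖u‖² = ‖u‖²_{L²} + ‖Δu‖²_{L²}`. -/
def h2norm (u : H2) : ℝ := Real.sqrt (‖(u : L2)‖ ^ 2 + ‖lap u‖ ^ 2)

/-- `g` is the weak derivative of `f` in the direction `v`. -/
def IsWeakDeriv (v : R3) (f g : R3 → ℝ) : Prop :=
  ∀ φ : R3 → ℝ, ContDiff ℝ ∞ φ → HasCompactSupport φ →
    ∫ x, f x * fderiv ℝ φ x v = - ∫ x, g x * φ x

/-- Membership in `W^{2,∞}(ℝ³, ℝ)`: `f` and its weak derivatives of orders one and two are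
essentially bounded. -/
structure MemW2Inf (f : R3 → ℝ) : Prop where
  memLp : MemLp f ∞ volume
  deriv : ∀ v w : R3, ∃ g h : R3 → ℝ,
    MemLp g ∞ volume ∧ IsWeakDeriv v f g ∧ MemLp h ∞ volume ∧ IsWeakDeriv w g h

/-- `⟨f | μ | g⟩ = ∫ conj (f x) μ(x) g(x) dx`. -/
def bracket (μ : R3 → ℝ) (f g : L2) : ℂ := ∫ x, conj (f x) * ((μ x : ℂ) * g x)

/-- A positive symmetric bounded operator on `H²`. It is bounded for the norm of `H²`; symmetry
and positivity refer to the scalar product of `L²`. -/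
structure IsPosSymBounded (O : H2 →ₗ[ℂ] H2) : Prop where
  bounded : ∃ C : ℝ, ∀ u : H2, h2norm (O u) ≤ C * h2norm u
  symm : ∀ u v : H2, inner ℂ (O u : L2) (v : L2) = inner ℂ (u : L2) (O v : L2)
  pos : ∀ u : H2, 0 ≤ (inner ℂ (u : L2) (O u : L2)).re

/-- `ψ ∈ L^∞(0,T;H²) ∩ W^{1,∞}(0,T;L²)` solves `i ∂ₜψ = (-Δ + V - ε(t) μ) ψ` on `(0,T)`.
The function `ψ` is its representative on `[0,T]` that is Lipschitz with values in `L²`; this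
representative takes values in `H²`, with bounded norm, at every time of `[0,T]`. -/
structure IsSchrodingerSol (T : ℝ) (V μ : R3 → ℝ) (ε : ℝ → ℝ) (ψ : ℝ → H2) : Prop where
  bounded_H2 : ∃ C : ℝ, ∀ t ∈ Set.Icc 0 T, h2norm (ψ t) ≤ C
  lipschitz_L2 : ∃ K : NNReal, LipschitzOnWith K (fun t => (ψ t : L2)) (Set.Icc 0 T)
  equation : ∀ᵐ t ∂(volume.restrict (Set.Ioo 0 T)), ∃ d : L2,
    HasDerivAt (fun s => (ψ s : L2)) d t ∧
    ∀ᵐ x ∂(volume : Measure R3), Complex.I * d x =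
      -(lap (ψ t) x) + ((V x : ℝ) : ℂ) * (ψ t : L2) x
        - ((ε t : ℝ) : ℂ) * ((μ x : ℝ) : ℂ) * (ψ t : L2) x

/-- The state `ψ` of the control `ε`: the solution with `ψ(0) = ψ₀`. -/
def IsState (T : ℝ) (V μ : R3 → ℝ) (ψ₀ : H2) (ε : ℝ → ℝ) (ψ : ℝ → H2) : Prop :=
  IsSchrodingerSol T V μ ε ψ ∧ ψ 0 = ψ₀

/-- The adjoint state `χ` of the control `ε` and the final state `ψT`: the solution with
`χ(T) = O ψT`. -/
def IsAdjoint (T : ℝ) (V μ : R3 → ℝ) (O : H2 →ₗ[ℂ] H2) (ψT : H2) (ε : ℝ → ℝ)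
    (χ : ℝ → H2) : Prop :=
  IsSchrodingerSol T V μ ε χ ∧ χ T = O ψT

/-- The function `∇J(ε)`, `t ↦ -2 (α ε(t) + Im ⟨χ(t)|μ|ψ(t)⟩)`, where `ψ` and `χ` are the state
and the adjoint state of the control `ε`. It is the `L²(0,T)`-gradient at `ε` of
`J(ε) = ⟨ψ(T)|O|ψ(T)⟩ - α ∫₀ᵀ ε(t)² dt`. -/
def gradJ (μ : R3 → ℝ) (α : ℝ) (ε : ℝ → ℝ) (ψ χ : ℝ → H2) : ℝ → ℝ :=
  fun t => -2 * (α * ε t + (bracket μ (χ t : L2) (ψ t : L2)).im)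

/-- The monotonic scheme: `ε k` and `ε' k` are the controls written `εᵏ` and `ε̃ᵏ`, and `ψ k`, `χ k`
are the states and adjoint states that they generate. -/
structure IsMonotonicScheme (T : ℝ) (V μ : R3 → ℝ) (O : H2 →ₗ[ℂ] H2) (α δ η : ℝ) (ψ₀ : H2)
    (ε ε' : ℕ → ℝ → ℝ) (ψ χ : ℕ → ℝ → H2) : Prop where
  init : MemLp (ε 0) ∞ (volume.restrict (Set.Ioo 0 T))
  init' : MemLp (ε' 0) ∞ (volume.restrict (Set.Ioo 0 T))
  state : ∀ k, IsState T V μ ψ₀ (ε k) (ψ k)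
  adjoint : ∀ k, IsAdjoint T V μ O (ψ k T) (ε' k) (χ k)
  update : ∀ k, ∀ᵐ t ∂(volume.restrict (Set.Ioo 0 T)),
    ε (k + 1) t = (1 - δ) * ε' k t
      - δ / α * (bracket μ (χ k t : L2) (ψ (k + 1) t : L2)).im
  update' : ∀ k, ∀ᵐ t ∂(volume.restrict (Set.Ioo 0 T)),
    ε' (k + 1) t = (1 - η) * ε (k + 1) t
      - η / α * (bracket μ (χ (k + 1) t : L2) (ψ (k + 1) t : L2)).im

end

/-! ### The Laplacian on `H²` -/

/-! Solving the update rule for `Im ⟨χᵏ⁻¹|μ|ψᵏ⟩` turns the gradient into `2α(1/δ - 1)(εᵏ - ε̃ᵏ⁻¹) -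
2 Im ⟨χ - χᵏ⁻¹|μ|ψᵏ⟩`, with `χ` the adjoint state of `εᵏ`. So it suffices to bound `χ - χᵏ⁻¹` in
`L²`.

The tool is `IsSchrodingerSol.norm_sub_le`: since `-Δ + V - εμ` is symmetric, the `L²` distance of
two solutions grows by at most a multiple of the `L¹` distance of their controls, whatever `V` is.
For the adjoint states the controls differ by `εᵏ - ε̃ᵏ⁻¹`, and the final data by `O(ψᵏ(T) -
ψᵏ⁻¹(T))`. A second use of stability bounds the latter by `εᵏ - ε̃ᵏ⁻¹` and `ε̃ᵏ⁻¹ - εᵏ⁻¹`, provided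
`O` is bounded for the `L²` norm. This follows from symmetry and boundedness on `H²`
(`IsPosSymBounded.exists_norm_le`, Lax's argument). Working only in `L²` keeps the constant
independent of `V`. -/

theorem toTemperedDistribution_injective {f g : L2} (h : (f : 𝓢'(R3, ℂ)) = (g : 𝓢'(R3, ℂ))) :
    f = g := by
  have hinj := LinearMap.ker_eq_bot.1
    (Lp.ker_toTemperedDistributionCLM_eq_bot (F := ℂ) (μ := (volume : Measure R3)) (p := 2))
  exact hinj h

theorem lap_sub (u v : H2) : lap (u - v) = lap u - lap v := by
  apply toTemperedDistribution_injective
  rw [← lap_spec, ← Lp.toTemperedDistributionCLM_apply (lap u - lap v), map_sub,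
    Lp.toTemperedDistributionCLM_apply, Lp.toTemperedDistributionCLM_apply, ← lap_spec, ← lap_spec,
    Submodule.coe_sub, ← Lp.toTemperedDistributionCLM_apply (u - v : L2), map_sub,
    Lp.toTemperedDistributionCLM_apply, Lp.toTemperedDistributionCLM_apply,
    ← laplacianCLM_apply, ← laplacianCLM_apply, ← laplacianCLM_apply, map_sub]

theorem lap_zero : lap 0 = 0 := by
  simpa using lap_sub 0 0

/-- If `g` is the product of `f` with a real-valued function, then `⟨f, g⟩` is real. -/
theorem inner_im_eq_zero_of_real_mul {f g : L2} (c : R3 → ℝ)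
    (h : ∀ᵐ x ∂(volume : Measure R3), g x = (c x : ℂ) * f x) : (inner ℂ f g : ℂ).im = 0 := by
  have hsymm : (inner ℂ f g : ℂ) = inner ℂ g f := by
    rw [L2.inner_def, L2.inner_def]
    refine integral_congr_ae ?_
    filter_upwards [h] with x hx
    simp only [RCLike.inner_apply, hx, map_mul, Complex.conj_ofReal]
    ring
  have hconj : conj (inner ℂ f g : ℂ) = inner ℂ f g := by
    rw [inner_conj_symm, hsymm]
  exact Complex.conj_eq_iff_im.1 hconj

open FourierTransform in
/-- The Laplacian is the Fourier multiplier with symbol `-(2π)² ‖ξ‖²`. -/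
theorem fourier_lap_ae (u : H2) : ∀ᵐ ξ ∂(volume : Measure R3),
    (𝓕 (lap u) : L2) ξ = ((-(2 * Real.pi) ^ 2 * ‖ξ‖ ^ 2 : ℝ) : ℂ) * (𝓕 (u : L2) : L2) ξ := by
  have hspec : 𝓕 ((lap u : L2) : 𝓢'(R3, ℂ)) = (-(2 * Real.pi) ^ 2 : ℝ) •
      smulLeftCLM ℂ (fun ξ : R3 => ((‖ξ‖ ^ 2 : ℝ) : ℂ)) (𝓕 ((u : L2) : 𝓢'(R3, ℂ))) := by
    rw [← lap_spec, laplacian_eq_fourierMultiplierCLM, fourierMultiplierCLM_apply,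
      ← fourierCLM_apply (R := ℂ), ContinuousLinearMap.map_smul_of_tower, fourierCLM_apply,
      fourier_fourierInv_eq]
  rw [Lp.fourier_toTemperedDistribution_eq, Lp.fourier_toTemperedDistribution_eq] at hspec
  set F : L2 := 𝓕 (lap u)
  set G : L2 := 𝓕 (u : L2)
  -- The symbol `‖ξ‖²` is unbounded. After division by `1 + ‖ξ‖²` both sides are bounded multiples
  -- of `L²` functions and can be compared a.e.; the positive factor is cancelled at the end.
  set a : R3 → ℂ := fun ξ => (((1 + ‖ξ‖ ^ 2) ^ (-1 : ℝ) : ℝ) : ℂ) with ha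
  set b : R3 → ℂ := fun ξ => ((‖ξ‖ ^ 2 * (1 + ‖ξ‖ ^ 2) ^ (-1 : ℝ) : ℝ) : ℂ) with hb
  have ha₁ : a.HasTemperateGrowth := by fun_prop
  have hb₁ : b.HasTemperateGrowth := by fun_prop
  have ha₂ : MemLp a ∞ (volume : Measure R3) := by
    refine memLp_top_of_bound ha₁.1.continuous.aestronglyMeasurable 1 (ae_of_all _ fun ξ => ?_)
    rw [ha, Complex.norm_real, Real.rpow_neg_one, norm_inv, Real.norm_of_nonneg (by positivity)]
    exact inv_le_one_of_one_le₀ (by nlinarith [sq_nonneg ‖ξ‖])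
  have hb₂ : MemLp b ∞ (volume : Measure R3) := by
    refine memLp_top_of_bound hb₁.1.continuous.aestronglyMeasurable 1 (ae_of_all _ fun ξ => ?_)
    rw [hb, Complex.norm_real, Real.rpow_neg_one, Real.norm_of_nonneg (by positivity),
      ← div_eq_mul_inv]
    exact div_le_one_of_le₀ (by nlinarith [sq_nonneg ‖ξ‖]) (by positivity)
  have key : (ha₂.toLp a • F : L2) = (-(2 * Real.pi) ^ 2 : ℝ) • (hb₂.toLp b • G : L2) := by
    apply toTemperedDistribution_injective
    have hr : (((-(2 * Real.pi) ^ 2 : ℝ) • (hb₂.toLp b • G : L2) : L2) : 𝓢'(R3, ℂ)) =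
        (-(2 * Real.pi) ^ 2 : ℝ) • ((hb₂.toLp b • G : L2) : 𝓢'(R3, ℂ)) :=
      (Lp.toTemperedDistributionCLM ℂ (volume : Measure R3) 2).map_smul_of_tower _ _
    rw [hr, Lp.toTemperedDistribution_smul_eq ha₁, Lp.toTemperedDistribution_smul_eq hb₁, hspec,
      ContinuousLinearMap.map_smul_of_tower,
      smulLeftCLM_smulLeftCLM_apply (by fun_prop) (by fun_prop)]
    congr 3
    ext ξ
    simp [ha, hb]
  have hL := Lp.coeFn_lpSMul (r := 2) (ha₂.toLp a) F
  have hR := Lp.coeFn_lpSMul (r := 2) (hb₂.toLp b) G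
  have hS := Lp.coeFn_smul (-(2 * Real.pi) ^ 2 : ℝ) (hb₂.toLp b • G : L2)
  rw [key] at hL
  filter_upwards [hL, hR, hS, ha₂.coeFn_toLp, hb₂.coeFn_toLp] with ξ h1 h2 h3 h4 h5
  rw [h3] at h1
  simp only [Pi.smul_apply, Pi.smul_apply', smul_eq_mul, h4] at h1
  rw [h2, Pi.smul_apply', h5] at h1
  have hpos : (0 : ℝ) < 1 + ‖ξ‖ ^ 2 := by positivity
  have hne : ((1 + ‖ξ‖ ^ 2 : ℝ) : ℂ) ≠ 0 := by exact_mod_cast hpos.ne'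
  simp only [ha, hb, Real.rpow_neg_one, Complex.real_smul, smul_eq_mul, Complex.ofReal_mul,
    Complex.ofReal_inv] at h1
  field_simp at h1
  rw [← h1]
  push_cast
  ring

open FourierTransform in
/-- `⟨u, Δu⟩` is real. -/
theorem inner_lap_im (u : H2) : (inner ℂ (u : L2) (lap u) : ℂ).im = 0 := by
  rw [← Lp.inner_fourier_eq]
  exact inner_im_eq_zero_of_real_mul _ (fourier_lap_ae u)

/-! ### Multiplication by a bounded real function -/

/-- Multiplication by `μ ∈ L^∞`, as a bounded operator on `L²`. -/
noncomputable def mulCLM {μ : R3 → ℝ} (hμ : MemLp μ ∞ (volume : Measure R3)) : L2 →L[ℂ] L2 :=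
  LinearMap.mkContinuous
    { toFun := fun g => ((hμ.ofReal (K := ℂ)).toLp _ • g : L2)
      map_add' := fun g h => Lp.add_smul _ g h
      map_smul' := fun c g => (Lp.smul_comm c _ g).symm }
    ‖(hμ.ofReal (K := ℂ)).toLp _‖ fun g => Lp.norm_smul_le _ g

theorem mulCLM_ae {μ : R3 → ℝ} (hμ : MemLp μ ∞ (volume : Measure R3)) (g : L2) :
    ∀ᵐ x ∂(volume : Measure R3), mulCLM hμ g x = (μ x : ℂ) * g x := by
  have h1 := Lp.coeFn_lpSMul (r := 2) ((hμ.ofReal (K := ℂ)).toLp _) g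
  filter_upwards [h1, (hμ.ofReal (K := ℂ)).coeFn_toLp] with x hx hx'
  rw [Pi.smul_apply', hx'] at hx
  exact hx

theorem bracket_eq_inner {μ : R3 → ℝ} (hμ : MemLp μ ∞ (volume : Measure R3)) (f g : L2) :
    bracket μ f g = inner ℂ f (mulCLM hμ g) := by
  rw [bracket, L2.inner_def]
  refine integral_congr_ae ?_
  filter_upwards [mulCLM_ae hμ g] with x hx
  rw [RCLike.inner_apply, hx]
  ring

theorem bracket_sub_left {μ : R3 → ℝ} (hμ : MemLp μ ∞ (volume : Measure R3)) (f₁ f₂ g : L2) :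
    bracket μ (f₁ - f₂) g = bracket μ f₁ g - bracket μ f₂ g := by
  simp only [bracket_eq_inner hμ, inner_sub_left]

theorem norm_bracket_le {μ : R3 → ℝ} (hμ : MemLp μ ∞ (volume : Measure R3)) (f g : L2) :
    ‖bracket μ f g‖ ≤ ‖mulCLM hμ‖ * ‖f‖ * ‖g‖ := by
  rw [bracket_eq_inner hμ]
  calc _ ≤ ‖f‖ * ‖mulCLM hμ g‖ := norm_inner_le_norm _ _
    _ ≤ ‖f‖ * (‖mulCLM hμ‖ * ‖g‖) := by gcongr; exact (mulCLM hμ).le_opNorm g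
    _ = _ := by ring

theorem continuousOn_bracket {μ : R3 → ℝ} (hμ : MemLp μ ∞ (volume : Measure R3))
    {f g : ℝ → L2} {s : Set ℝ} (hf : ContinuousOn f s) (hg : ContinuousOn g s) :
    ContinuousOn (fun t => bracket μ (f t) (g t)) s := by
  simp only [bracket_eq_inner hμ]
  exact ContinuousOn.inner (𝕜 := ℂ) hf ((mulCLM hμ).continuous.comp_continuousOn hg)

/-! ### Bounded symmetric operators on `H²` are bounded for the norm of `L²` -/

theorem norm_le_h2norm (u : H2) : ‖(u : L2)‖ ≤ h2norm u :=
  Real.le_sqrt_of_sq_le (le_add_of_nonneg_right (sq_nonneg _))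

theorem inner_iterate_symm {O : H2 →ₗ[ℂ] H2} (hO : IsPosSymBounded O) (n : ℕ) (u v : H2) :
    (inner ℂ (O^[n] u : L2) (v : L2) : ℂ) = inner ℂ (u : L2) (O^[n] v : L2) := by
  induction n generalizing u v with
  | zero => rfl
  | succ n ih => rw [Function.iterate_succ_apply, ih, hO.symm, ← Function.iterate_succ_apply' O]

/-- Symmetry moves `n` factors of `O` across the scalar product; then Cauchy–Schwarz. -/
theorem sq_norm_iterate_le {O : H2 →ₗ[ℂ] H2} (hO : IsPosSymBounded O) (n : ℕ) (u : H2) :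
    ‖(O^[n] u : L2)‖ ^ 2 ≤ ‖(u : L2)‖ * ‖(O^[2 * n] u : L2)‖ := by
  have h : (inner ℂ (O^[n] u : L2) (O^[n] u : L2) : ℂ) = inner ℂ (u : L2) (O^[2 * n] u : L2) := by
    rw [inner_iterate_symm hO, ← Function.iterate_add_apply, two_mul]
  calc ‖(O^[n] u : L2)‖ ^ 2 = ‖(inner ℂ (O^[n] u : L2) (O^[n] u : L2) : ℂ)‖ := by
        rw [inner_self_eq_norm_sq_to_K]; simp
    _ ≤ _ := by rw [h]; exact norm_inner_le_norm _ _

/-- Repeated doubling with `sq_norm_iterate_le`. The `L²` growth of one application is thus tied to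
a high iterate, where the crude `H²` bound suffices. -/
theorem norm_pow_two_pow_le {O : H2 →ₗ[ℂ] H2} (hO : IsPosSymBounded O) (n : ℕ) (u : H2) :
    ‖(O u : L2)‖ ^ 2 ^ n * ‖(u : L2)‖ ≤ ‖(u : L2)‖ ^ 2 ^ n * ‖(O^[2 ^ n] u : L2)‖ := by
  induction n with
  | zero => simp [mul_comm]
  | succ n ih =>
    rcases (norm_nonneg (u : L2)).eq_or_lt with h0 | hpos
    · simp [← h0]
    · have h1 := sq_norm_iterate_le hO (2 ^ n) u
      rw [← pow_succ'] at h1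
      have h2 : (‖(O u : L2)‖ ^ 2 ^ n * ‖(u : L2)‖) ^ 2 ≤
          (‖(u : L2)‖ ^ 2 ^ n * ‖(O^[2 ^ n] u : L2)‖) ^ 2 := by gcongr
      rw [mul_pow, mul_pow, ← pow_mul, ← pow_mul, ← pow_succ] at h2
      refine le_of_mul_le_mul_right ?_ hpos
      calc _ = ‖(O u : L2)‖ ^ 2 ^ (n + 1) * ‖(u : L2)‖ ^ 2 := by ring
        _ ≤ _ := h2
        _ ≤ ‖(u : L2)‖ ^ 2 ^ (n + 1) * (‖(u : L2)‖ * ‖(O^[2 ^ (n + 1)] u : L2)‖) := by gcongr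
        _ = _ := by ring

theorem h2norm_iterate_le {O : H2 →ₗ[ℂ] H2} {C : ℝ} (hC : 0 ≤ C)
    (h : ∀ u : H2, h2norm (O u) ≤ C * h2norm u) (n : ℕ) (u : H2) :
    h2norm (O^[n] u) ≤ C ^ n * h2norm u := by
  induction n with
  | zero => simp
  | succ n ih =>
    rw [Function.iterate_succ_apply']
    calc _ ≤ C * (C ^ n * h2norm u) := (h _).trans (by gcongr)
      _ = _ := by ring

/-- A symmetric operator that is bounded on `H²` is bounded for the norm of `L²`. -/
theorem IsPosSymBounded.exists_norm_le {O : H2 →ₗ[ℂ] H2} (hO : IsPosSymBounded O) :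
    ∃ C : ℝ, 0 < C ∧ ∀ u : H2, ‖(O u : L2)‖ ≤ C * ‖(u : L2)‖ := by
  obtain ⟨C₀, hC₀⟩ := hO.bounded
  obtain ⟨C, hCpos, hC⟩ : ∃ C : ℝ, 0 < C ∧ ∀ u : H2, h2norm (O u) ≤ C * h2norm u :=
    ⟨max C₀ 1, by positivity, fun u => (hC₀ u).trans <|
      mul_le_mul_of_nonneg_right (le_max_left _ _) (Real.sqrt_nonneg _)⟩
  refine ⟨C, hCpos, fun u => ?_⟩
  rcases (norm_nonneg (u : L2)).eq_or_lt with h0 | hpos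
  · have hu : u = 0 := Subtype.ext (norm_eq_zero.1 h0.symm)
    simp [hu]
  by_contra! hlt
  have hCu : 0 < C * ‖(u : L2)‖ := by positivity
  -- The ratio `‖Ou‖ / (C‖u‖)` exceeds 1, yet its powers of exponent `2 ^ n` stay below `h2norm u /
  -- ‖u‖`.
  obtain ⟨n, hn⟩ := pow_unbounded_of_one_lt (h2norm u / ‖(u : L2)‖) ((one_lt_div hCu).2 hlt)
  have hle : (‖(O u : L2)‖ / (C * ‖(u : L2)‖)) ^ 2 ^ n ≤ h2norm u / ‖(u : L2)‖ := by
    rw [div_pow, div_le_div_iff₀ (by positivity) hpos, mul_pow]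
    calc _ ≤ _ := norm_pow_two_pow_le hO n u
      _ ≤ ‖(u : L2)‖ ^ 2 ^ n * (C ^ 2 ^ n * h2norm u) := by
        gcongr
        exact (norm_le_h2norm _).trans (h2norm_iterate_le hCpos.le hC _ u)
      _ = _ := by ring
  have hmono := pow_le_pow_right₀ ((one_lt_div hCu).2 hlt).le n.lt_two_pow_self.le
  linarith

/-! ### Energy estimates for the Schrödinger equation -/

theorem IsSchrodingerSol.continuousOn {T : ℝ} {V μ : R3 → ℝ} {ε : ℝ → ℝ} {ψ : ℝ → H2}
    (h : IsSchrodingerSol T V μ ε ψ) : ContinuousOn (fun t => (ψ t : L2)) (Set.Icc 0 T) :=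
  h.lipschitz_L2.choose_spec.continuousOn

/-- Comparison with this solution turns the stability estimate into conservation of the norm. -/
theorem isSchrodingerSol_zero (T : ℝ) (V μ : R3 → ℝ) (ε : ℝ → ℝ) :
    IsSchrodingerSol T V μ ε fun _ => 0 where
  bounded_H2 := ⟨h2norm 0, fun _ _ => le_rfl⟩
  lipschitz_L2 := ⟨0, LipschitzOnWith.of_dist_le_mul fun _ _ _ _ => by simp⟩
  equation := ae_of_all _ fun t => by
    refine ⟨0, hasDerivAt_const t _, ?_⟩
    filter_upwards [Lp.coeFn_zero ℂ 2 (volume : Measure R3)] with x hx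
    simp only [lap_zero, Submodule.coe_zero, hx]
    simp

/-- The rate of change of the squared distance of two solutions. -/
theorem IsSchrodingerSol.hasDerivAt_norm_sub_sq {T : ℝ} {V μ : R3 → ℝ}
    (hμ : MemLp μ ∞ (volume : Measure R3)) {εa εb : ℝ → ℝ} {ψa ψb : ℝ → H2}
    (ha : IsSchrodingerSol T V μ εa ψa) (hb : IsSchrodingerSol T V μ εb ψb) :
    ∀ᵐ t ∂(volume.restrict (Set.Ioo 0 T)), ∃ d : ℝ,
      HasDerivAt (fun s => ‖(ψa s - ψb s : L2)‖ ^ 2) d t ∧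
      |d| ≤ 2 * (|εa t - εb t| * (‖mulCLM hμ‖ * ‖(ψa t - ψb t : L2)‖ * ‖(ψb t : L2)‖)) := by
  filter_upwards [ha.equation, hb.equation] with t ⟨da, hda, hea⟩ ⟨db, hdb, heb⟩
  set w : H2 := ψa t - ψb t with hw
  have hd := hda.sub hdb
  have hsq := (Complex.reCLM.hasFDerivAt.comp_hasDerivAt t (hd.inner ℂ hd))
  -- By the two equations `r = (V - εa μ) w`, so `⟨w, r⟩` is real and `V` disappears without being
  -- estimated.
  set r : L2 := Complex.I • (da - db) + lap w +
    ((εa t - εb t : ℝ) : ℂ) • mulCLM hμ (ψb t) with hr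
  have hreal : (inner ℂ (w : L2) r : ℂ).im = 0 := by
    refine inner_im_eq_zero_of_real_mul (fun x => V x - εa t * μ x) ?_
    rw [hr, hw, lap_sub]
    filter_upwards [hea, heb, mulCLM_ae hμ (ψb t), Lp.coeFn_sub da db,
      Lp.coeFn_sub (lap (ψa t)) (lap (ψb t)), Lp.coeFn_sub (ψa t : L2) (ψb t),
      Lp.coeFn_smul Complex.I (da - db),
      Lp.coeFn_smul ((εa t - εb t : ℝ) : ℂ) (mulCLM hμ (ψb t)),
      Lp.coeFn_add (Complex.I • (da - db)) (lap (ψa t) - lap (ψb t)),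
      Lp.coeFn_add (Complex.I • (da - db) + (lap (ψa t) - lap (ψb t)))
        (((εa t - εb t : ℝ) : ℂ) • mulCLM hμ (ψb t))] with x h1 h2 h3 h4 h5 h6 h7 h8 h9 h10
    rw [h10, Pi.add_apply, h9, Pi.add_apply, h8, h7, Pi.smul_apply, Pi.smul_apply, h3, h4, h5,
      Submodule.coe_sub, h6]
    simp only [Pi.sub_apply, smul_eq_mul, mul_sub, h1, h2]
    push_cast
    ring
  have hre : (inner ℂ (w : L2) (da - db) : ℂ).re =
      -((εa t - εb t) * (bracket μ w (ψb t)).im) := by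
    have hIm : (inner ℂ (w : L2) r : ℂ).im = (inner ℂ (w : L2) (da - db) : ℂ).re +
        (inner ℂ (w : L2) (lap w) : ℂ).im + (εa t - εb t) * (bracket μ w (ψb t)).im := by
      rw [hr, inner_add_right, inner_add_right, inner_smul_right, inner_smul_right,
        ← bracket_eq_inner, Complex.add_im, Complex.add_im, Complex.I_mul_im, Complex.im_ofReal_mul]
    rw [hreal, inner_lap_im] at hIm
    linarith
  refine ⟨2 * (inner ℂ (w : L2) (da - db) : ℂ).re, ?_, ?_⟩
  · have hderiv : Complex.reCLM (inner ℂ (w : L2) (da - db) + inner ℂ (da - db) (w : L2)) =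
        2 * (inner ℂ (w : L2) (da - db) : ℂ).re := by
      rw [← inner_conj_symm (da - db) (w : L2), Complex.reCLM_apply, Complex.add_re,
        Complex.conj_re, two_mul]
    rw [← hderiv]
    refine hsq.congr_of_eventuallyEq (Filter.Eventually.of_forall fun s => ?_)
    exact (inner_self_eq_norm_sq (𝕜 := ℂ) (ψa s - ψb s : L2)).symm
  · rw [hre, abs_mul, abs_neg, abs_mul, abs_two]
    gcongr
    exact (Complex.abs_im_le_norm _).trans (norm_bracket_le hμ _ _)

/-- The increments of the squared distance of two solutions. -/
theorem IsSchrodingerSol.abs_norm_sub_sq_sub_le {T : ℝ} {V μ : R3 → ℝ}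
    (hμ : MemLp μ ∞ (volume : Measure R3)) {εa εb : ℝ → ℝ} {ψa ψb : ℝ → H2}
    (ha : IsSchrodingerSol T V μ εa ψa) (hb : IsSchrodingerSol T V μ εb ψb)
    (hε : IntegrableOn (fun t => εa t - εb t) (Set.Ioo 0 T)) {B S : ℝ} (hS₀ : 0 ≤ S)
    (hB : ∀ t ∈ Set.Icc 0 T, ‖(ψb t : L2)‖ ≤ B)
    (hS : ∀ t ∈ Set.Icc 0 T, ‖(ψa t - ψb t : L2)‖ ≤ S) {s t : ℝ}
    (hs : s ∈ Set.Icc 0 T) (ht : t ∈ Set.Icc 0 T) :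
    |‖(ψa t - ψb t : L2)‖ ^ 2 - ‖(ψa s - ψb s : L2)‖ ^ 2| ≤
      2 * (‖mulCLM hμ‖ * S * B) * ∫ τ in Set.Ioo 0 T, |εa τ - εb τ| := by
  wlog hst : s ≤ t generalizing s t
  · rw [abs_sub_comm]
    exact this ht hs (le_of_not_ge hst)
  have hB₀ : 0 ≤ B := (norm_nonneg _).trans (hB s hs)
  have hsub : Set.uIcc s t ⊆ Set.Icc 0 T := by
    rw [Set.uIcc_of_le hst]
    exact Set.Icc_subset_Icc hs.1 ht.2
  obtain ⟨Ka, hKa⟩ := ha.lipschitz_L2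
  obtain ⟨Kb, hKb⟩ := hb.lipschitz_L2
  have hlip : LipschitzOnWith (1 * (Ka + Kb)) (fun τ => ‖(ψa τ - ψb τ : L2)‖) (Set.uIcc s t) :=
    lipschitzWith_one_norm.comp_lipschitzOnWith ((hKa.sub hKb).mono hsub)
  -- The derivative is known only a.e.; absolute continuity allows it to be integrated.
  have hac := hlip.absolutelyContinuousOnInterval.mul hlip.absolutelyContinuousOnInterval
  have hftc := hac.integral_deriv_eq_sub
  have hfun : ((fun τ => ‖(ψa τ - ψb τ : L2)‖) * fun τ => ‖(ψa τ - ψb τ : L2)‖) =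
      fun τ => ‖(ψa τ - ψb τ : L2)‖ ^ 2 := by
    ext τ
    simp [pow_two]
  rw [hfun] at hftc
  rw [← hftc, ← integral_const_mul]
  have hint : IntegrableOn (fun τ => 2 * (‖mulCLM hμ‖ * S * B) * |εa τ - εb τ|) (Set.Ioo 0 T) :=
    hε.abs.const_mul _
  have hsub' : Set.Ioo s t ⊆ Set.Ioo 0 T := Set.Ioo_subset_Ioo hs.1 ht.2
  rw [intervalIntegral.integral_of_le hst, integral_Ioc_eq_integral_Ioo, ← Real.norm_eq_abs]
  refine le_trans ?_
    (setIntegral_mono_set hint (ae_of_all _ fun τ => by positivity) hsub'.eventuallyLE)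
  refine norm_integral_le_of_norm_le (hint.mono_set hsub') ?_
  have hae := ae_restrict_of_ae_restrict_of_subset hsub' (ha.hasDerivAt_norm_sub_sq hμ hb)
  filter_upwards [hae, ae_restrict_mem measurableSet_Ioo] with τ ⟨d, hd, hle⟩ hτ
  have hτ' : τ ∈ Set.Icc 0 T := Set.Ioo_subset_Icc_self (hsub' hτ)
  rw [hd.deriv, Real.norm_eq_abs]
  calc |d| ≤ _ := hle
    _ ≤ 2 * (|εa τ - εb τ| * (‖mulCLM hμ‖ * S * B)) := by
      gcongr
      exacts [hS τ hτ', hB τ hτ']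
    _ = _ := by ring

/-- Stability of solutions with respect to the control and to the data at time `s`. -/
theorem IsSchrodingerSol.norm_sub_le {T : ℝ} {V μ : R3 → ℝ}
    (hμ : MemLp μ ∞ (volume : Measure R3)) {εa εb : ℝ → ℝ} {ψa ψb : ℝ → H2}
    (ha : IsSchrodingerSol T V μ εa ψa) (hb : IsSchrodingerSol T V μ εb ψb)
    (hε : IntegrableOn (fun t => εa t - εb t) (Set.Ioo 0 T)) {B : ℝ}
    (hB : ∀ t ∈ Set.Icc 0 T, ‖(ψb t : L2)‖ ≤ B) {s t : ℝ}
    (hs : s ∈ Set.Icc 0 T) (ht : t ∈ Set.Icc 0 T) :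
    ‖(ψa t - ψb t : L2)‖ ≤ ‖(ψa s - ψb s : L2)‖ +
      2 * (‖mulCLM hμ‖ * B) * ∫ τ in Set.Ioo 0 T, |εa τ - εb τ| := by
  have hcont : ContinuousOn (fun τ => ‖(ψa τ - ψb τ : L2)‖) (Set.Icc 0 T) :=
    (ha.continuousOn.sub hb.continuousOn).norm
  -- With `S` the maximal distance, the increment bound reads `S² ≤ a² + cS`, where `a` is the
  -- distance at time `s`; hence `S ≤ a + c`.
  obtain ⟨m, hm, hmax⟩ := isCompact_Icc.exists_isMaxOn ⟨s, hs⟩ hcont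
  have hB₀ : 0 ≤ B := (norm_nonneg _).trans (hB s hs)
  refine (hmax ht).trans ?_
  have hle := (abs_le.1 (ha.abs_norm_sub_sq_sub_le hμ hb hε (norm_nonneg (ψa m - ψb m : L2)) hB
    (fun τ hτ => hmax hτ) hs hm)).2
  have hI : 0 ≤ ∫ τ in Set.Ioo 0 T, |εa τ - εb τ| := integral_nonneg fun _ => abs_nonneg _
  set I := ∫ τ in Set.Ioo 0 T, |εa τ - εb τ|
  have hc : 0 ≤ 2 * (‖mulCLM hμ‖ * B) * I := by positivity
  have hle' : ‖(ψa m - ψb m : L2)‖ ^ 2 ≤ ‖(ψa s - ψb s : L2)‖ ^ 2 +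
      (2 * (‖mulCLM hμ‖ * B) * I) * ‖(ψa m - ψb m : L2)‖ := by linarith
  have h0 := norm_nonneg (ψa s - ψb s : L2)
  change ‖(ψa m - ψb m : L2)‖ ≤ _
  by_contra! hlt
  nlinarith [mul_nonneg h0 hc]

/-- The norm of a solution is constant. -/
theorem IsSchrodingerSol.norm_eq {T : ℝ} {V μ : R3 → ℝ}
    (hμ : MemLp μ ∞ (volume : Measure R3)) {ε : ℝ → ℝ} {ψ : ℝ → H2}
    (h : IsSchrodingerSol T V μ ε ψ) {s t : ℝ} (hs : s ∈ Set.Icc 0 T) (ht : t ∈ Set.Icc 0 T) :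
    ‖(ψ t : L2)‖ = ‖(ψ s : L2)‖ := by
  have key : ∀ {s t : ℝ}, s ∈ Set.Icc 0 T → t ∈ Set.Icc 0 T → ‖(ψ t : L2)‖ ≤ ‖(ψ s : L2)‖ :=
    fun {s t} hs ht => by
      simpa using h.norm_sub_le hμ (isSchrodingerSol_zero T V μ ε) (by simp) (B := 0) (by simp) hs ht
  exact (key hs ht).antisymm (key ht hs)

/-- Two solutions for the same control that agree at one time are equal. -/
theorem IsSchrodingerSol.eq_of_eq {T : ℝ} {V μ : R3 → ℝ}
    (hμ : MemLp μ ∞ (volume : Measure R3)) {ε : ℝ → ℝ} {ψa ψb : ℝ → H2}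
    (ha : IsSchrodingerSol T V μ ε ψa) (hb : IsSchrodingerSol T V μ ε ψb) {s t : ℝ}
    (hs : s ∈ Set.Icc 0 T) (ht : t ∈ Set.Icc 0 T) (h : ψa s = ψb s) : ψa t = ψb t := by
  have hle := ha.norm_sub_le hμ hb (by simp) (fun τ hτ => (hb.norm_eq hμ hs hτ).le) hs ht
  rw [h] at hle
  simp only [sub_self, norm_zero, abs_zero, integral_zero, mul_zero, add_zero] at hle
  exact Subtype.ext (sub_eq_zero.1 (norm_le_zero_iff.1 hle))

/-! ### The gradient estimate for the monotonic scheme -/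

theorem IsSchrodingerSol.memLp_bracket {T : ℝ} {V μ : R3 → ℝ}
    (hμ : MemLp μ ∞ (volume : Measure R3)) {εa εb : ℝ → ℝ} {ψa ψb : ℝ → H2}
    (ha : IsSchrodingerSol T V μ εa ψa) (hb : IsSchrodingerSol T V μ εb ψb) :
    MemLp (fun t => (bracket μ (ψa t : L2) (ψb t : L2)).im) ∞ (volume.restrict (Set.Ioo 0 T)) := by
  have hcont : ContinuousOn (fun t => (bracket μ (ψa t : L2) (ψb t : L2)).im) (Set.Icc 0 T) :=
    Complex.continuous_im.comp_continuousOn (continuousOn_bracket hμ ha.continuousOn hb.continuousOn)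
  obtain ⟨K, hK⟩ := isCompact_Icc.exists_bound_of_continuousOn hcont
  refine memLp_top_of_bound
    ((hcont.mono Set.Ioo_subset_Icc_self).aestronglyMeasurable measurableSet_Ioo) K ?_
  filter_upwards [ae_restrict_mem measurableSet_Ioo] with t ht
  exact hK t (Set.Ioo_subset_Icc_self ht)

/-- The updates preserve boundedness because the brackets are continuous on `[0,T]`. -/
theorem IsMonotonicScheme.memLp {T : ℝ} {V μ : R3 → ℝ} {O : H2 →ₗ[ℂ] H2} {α δ η : ℝ} {ψ₀ : H2}
    {ε ε' : ℕ → ℝ → ℝ} {ψ χ : ℕ → ℝ → H2} (hμ : MemLp μ ∞ (volume : Measure R3))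
    (h : IsMonotonicScheme T V μ O α δ η ψ₀ ε ε' ψ χ) (k : ℕ) :
    MemLp (ε k) ∞ (volume.restrict (Set.Ioo 0 T)) ∧
      MemLp (ε' k) ∞ (volume.restrict (Set.Ioo 0 T)) := by
  induction k with
  | zero => exact ⟨h.init, h.init'⟩
  | succ k ih =>
    have hε : MemLp (ε (k + 1)) ∞ (volume.restrict (Set.Ioo 0 T)) :=
      (memLp_congr_ae (h.update k)).2 <| (ih.2.const_mul _).sub <|
        ((h.adjoint k).1.memLp_bracket hμ (h.state (k + 1)).1).const_mul _
    exact ⟨hε, (memLp_congr_ae (h.update' k)).2 <| (hε.const_mul _).sub <|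
      ((h.adjoint (k + 1)).1.memLp_bracket hμ (h.state (k + 1)).1).const_mul _⟩

/-- Hölder on `(0,T)`, the source of the factor `√T`. -/
theorem ofReal_integral_abs_le {T : ℝ} (hT : 0 ≤ T) {f : ℝ → ℝ}
    (hf : MemLp f ∞ (volume.restrict (Set.Ioo 0 T))) :
    ENNReal.ofReal (∫ t in Set.Ioo 0 T, |f t|) ≤
      ENNReal.ofReal (√T) * eLpNorm f 2 (volume.restrict (Set.Ioo 0 T)) := by
  have h1 : Integrable f (volume.restrict (Set.Ioo 0 T)) := hf.integrable le_top
  calc ENNReal.ofReal (∫ t in Set.Ioo 0 T, |f t|)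
      = eLpNorm f 1 (volume.restrict (Set.Ioo 0 T)) := by
        rw [eLpNorm_one_eq_lintegral_enorm, ← ofReal_integral_norm_eq_lintegral_enorm h1]
        rfl
    _ ≤ _ := eLpNorm_le_eLpNorm_mul_rpow_measure_univ (q := 2) (by norm_num)
        h1.aestronglyMeasurable
    _ = _ := by
        rw [Measure.restrict_apply_univ, Real.volume_Ioo, sub_zero, mul_comm, Real.sqrt_eq_rpow]
        rw [ENNReal.ofReal_rpow_of_nonneg hT (by norm_num)]
        norm_num

/-- The `L²` bound of `O` serves twice: for the difference of the final data, and for the conserved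
norm of `χb`, which is at most `C`. -/
theorem IsAdjoint.norm_sub_le {T : ℝ} (hT : 0 ≤ T) {V μ : R3 → ℝ}
    (hμ : MemLp μ ∞ (volume : Measure R3)) {O : H2 →ₗ[ℂ] H2} {C : ℝ}
    (hC : ∀ u : H2, ‖(O u : L2)‖ ≤ C * ‖(u : L2)‖) {ψa ψb : H2}
    (hψb : ‖(ψb : L2)‖ = 1) {εa εb : ℝ → ℝ} {χa χb : ℝ → H2}
    (ha : IsAdjoint T V μ O ψa εa χa) (hb : IsAdjoint T V μ O ψb εb χb)
    (hε : IntegrableOn (fun t => εa t - εb t) (Set.Ioo 0 T)) {t : ℝ} (ht : t ∈ Set.Icc 0 T) :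
    ‖(χa t - χb t : L2)‖ ≤ C * ‖(ψa - ψb : L2)‖ +
      2 * (‖mulCLM hμ‖ * C) * ∫ τ in Set.Ioo 0 T, |εa τ - εb τ| := by
  have hTmem : T ∈ Set.Icc 0 T := ⟨hT, le_rfl⟩
  refine (ha.1.norm_sub_le hμ hb.1 hε (B := C) (fun τ hτ => ?_) hTmem ht).trans ?_
  · rw [hb.1.norm_eq hμ hTmem hτ, hb.2]
    simpa [hψb] using hC ψb
  · gcongr
    rw [ha.2, hb.2, ← Submodule.coe_sub, ← Submodule.coe_sub, ← map_sub]
    exact hC _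

theorem IsState.norm_eq {T : ℝ} {V μ : R3 → ℝ} (hμ : MemLp μ ∞ (volume : Measure R3))
    {ψ₀ : H2} {ε : ℝ → ℝ} {ψ : ℝ → H2} (h : IsState T V μ ψ₀ ε ψ) {t : ℝ}
    (ht : t ∈ Set.Icc 0 T) : ‖(ψ t : L2)‖ = ‖(ψ₀ : L2)‖ := by
  rw [h.1.norm_eq hμ ⟨le_rfl, ht.1.trans ht.2⟩ ht, h.2]

/-- Pointwise bound of the gradient by the increments of the controls of the scheme. -/
theorem IsMonotonicScheme.abs_gradJ_le {T : ℝ} (hT : 0 ≤ T) {V μ : R3 → ℝ}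
    (hμ : MemLp μ ∞ (volume : Measure R3)) {O : H2 →ₗ[ℂ] H2} {C : ℝ} (hC₀ : 0 ≤ C)
    (hC : ∀ u : H2, ‖(O u : L2)‖ ≤ C * ‖(u : L2)‖) {α δ η : ℝ} (hα : 0 < α) (hδ : 0 < δ)
    {ψ₀ : H2} (hψ₀ : ‖(ψ₀ : L2)‖ = 1) {ε ε' : ℕ → ℝ → ℝ} {ψ χ : ℕ → ℝ → H2}
    (h : IsMonotonicScheme T V μ O α δ η ψ₀ ε ε' ψ χ) (k : ℕ) {ψk χk : ℝ → H2}
    (hψk : IsState T V μ ψ₀ (ε (k + 1)) ψk) (hχk : IsAdjoint T V μ O (ψk T) (ε (k + 1)) χk) :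
    ∀ᵐ t ∂(volume.restrict (Set.Ioo 0 T)), |gradJ μ α (ε (k + 1)) ψk χk t| ≤
      2 * (α * |1 / δ - 1|) * |ε (k + 1) t - ε' k t| + 8 * ‖mulCLM hμ‖ ^ 2 * C *
        ((∫ τ in Set.Ioo 0 T, |ε (k + 1) τ - ε' k τ|) + ∫ τ in Set.Ioo 0 T, |ε' k τ - ε k τ|) := by
  have h0mem : (0 : ℝ) ∈ Set.Icc 0 T := ⟨le_rfl, hT⟩
  have hTmem : T ∈ Set.Icc 0 T := ⟨hT, le_rfl⟩
  have hi₁ : Integrable (fun t => ε (k + 1) t - ε' k t) (volume.restrict (Set.Ioo 0 T)) :=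
    ((h.memLp hμ (k + 1)).1.sub (h.memLp hμ k).2).integrable le_top
  have hi₂ : Integrable (fun t => ε' k t - ε k t) (volume.restrict (Set.Ioo 0 T)) :=
    ((h.memLp hμ k).2.sub (h.memLp hμ k).1).integrable le_top
  have hi₀ : Integrable (fun t => ε (k + 1) t - ε k t) (volume.restrict (Set.Ioo 0 T)) :=
    ((h.memLp hμ (k + 1)).1.sub (h.memLp hμ k).1).integrable le_top
  have hI : ∫ τ in Set.Ioo 0 T, |ε (k + 1) τ - ε k τ| ≤
      (∫ τ in Set.Ioo 0 T, |ε (k + 1) τ - ε' k τ|) + ∫ τ in Set.Ioo 0 T, |ε' k τ - ε k τ| := by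
    rw [← integral_add hi₁.abs hi₂.abs]
    exact integral_mono hi₀.abs (hi₁.abs.add hi₂.abs) fun τ => abs_sub_le _ _ _
  have hI₂ : 0 ≤ ∫ τ in Set.Ioo 0 T, |ε' k τ - ε k τ| := integral_nonneg fun _ => abs_nonneg _
  set I₁ := ∫ τ in Set.Ioo 0 T, |ε (k + 1) τ - ε' k τ|
  set I₂ := ∫ τ in Set.Ioo 0 T, |ε' k τ - ε k τ|
  have hψ : ∀ t ∈ Set.Icc 0 T, ψk t = ψ (k + 1) t := fun t ht =>
    hψk.1.eq_of_eq hμ (h.state (k + 1)).1 h0mem ht (by rw [hψk.2, (h.state (k + 1)).2])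
  have hfinal : ‖(ψk T - ψ k T : L2)‖ ≤ 2 * ‖mulCLM hμ‖ * (I₁ + I₂) := by
    have hle := hψk.1.norm_sub_le hμ (h.state k).1 hi₀ (B := 1)
      (fun τ hτ => ((h.state k).norm_eq hμ hτ).trans hψ₀ |>.le) h0mem hTmem
    rw [hψk.2, (h.state k).2, sub_self, norm_zero, zero_add, mul_one] at hle
    exact hle.trans (by gcongr)
  filter_upwards [h.update k, ae_restrict_mem measurableSet_Ioo] with t hupd ht
  replace ht : t ∈ Set.Icc 0 T := Set.Ioo_subset_Icc_self ht
  have hχ : ‖(χk t - χ k t : L2)‖ ≤ 4 * ‖mulCLM hμ‖ * C * (I₁ + I₂) :=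
    calc _ ≤ C * ‖(ψk T - ψ k T : L2)‖ + 2 * (‖mulCLM hμ‖ * C) * I₁ :=
          hχk.norm_sub_le hT hμ hC (((h.state k).norm_eq hμ hTmem).trans hψ₀) (h.adjoint k) hi₁ ht
      _ ≤ C * (2 * ‖mulCLM hμ‖ * (I₁ + I₂)) + 2 * (‖mulCLM hμ‖ * C) * (I₁ + I₂) := by
          gcongr
          linarith
      _ = _ := by ring
  have hb : |(bracket μ (χk t - χ k t : L2) (ψk t)).im| ≤
      4 * ‖mulCLM hμ‖ ^ 2 * C * (I₁ + I₂) :=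
    calc _ ≤ ‖mulCLM hμ‖ * ‖(χk t - χ k t : L2)‖ * ‖(ψk t : L2)‖ :=
          (Complex.abs_im_le_norm _).trans (norm_bracket_le hμ _ _)
      _ ≤ ‖mulCLM hμ‖ * (4 * ‖mulCLM hμ‖ * C * (I₁ + I₂)) * 1 := by
          rw [hψk.norm_eq hμ ht, hψ₀]
          gcongr
      _ = _ := by ring
  -- The update rule removes the bracket with `χ k`, leaving an increment of the controls and a
  -- difference of adjoint states.
  have heq : gradJ μ α (ε (k + 1)) ψk χk t = 2 * (α * (1 / δ - 1)) * (ε (k + 1) t - ε' k t) +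
      -2 * (bracket μ (χk t - χ k t : L2) (ψk t)).im := by
    rw [bracket_sub_left hμ, Complex.sub_im, gradJ, hψ t ht]
    have hupd' : (bracket μ (χ k t : L2) (ψ (k + 1) t : L2)).im =
        α / δ * ((1 - δ) * ε' k t - ε (k + 1) t) := by
      rw [hupd]
      field_simp
      ring
    rw [hupd']
    field_simp
    ring
  rw [heq]
  refine (abs_add_le _ _).trans ?_
  rw [abs_mul, abs_mul, abs_mul, abs_mul, abs_two, abs_of_pos hα, abs_neg, abs_two]
  linarith

theorem lemma6p3 (μ : R3 → ℝ) (hμ : MemW2Inf μ) (O : H2 →ₗ[ℂ] H2) (hO : IsPosSymBounded O)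
    (α δ η T : ℝ) (hα : 0 < α) (hδ : δ ∈ Set.Ioo (0 : ℝ) 2) (hη : η ∈ Set.Ioo (0 : ℝ) 2)
    (hT : 0 < T) :
    ∃ Λ : ℝ, 0 < Λ ∧
      ∀ (V : R3 → ℝ), MemW2Inf V →
      ∀ (ψ₀ : H2), ‖(ψ₀ : L2)‖ = 1 →
      ∀ (ε ε' : ℕ → ℝ → ℝ) (ψ χ : ℕ → ℝ → H2),
        IsMonotonicScheme T V μ O α δ η ψ₀ ε ε' ψ χ →
      ∀ (k : ℕ), 1 ≤ k →
      ∀ (ψk χk : ℝ → H2), IsState T V μ ψ₀ (ε k) ψk → IsAdjoint T V μ O (ψk T) (ε k) χk →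
        MemLp (gradJ μ α (ε k) ψk χk) 1 (volume.restrict (Set.Ioo 0 T)) ∧
        eLpNorm (gradJ μ α (ε k) ψk χk) 1 (volume.restrict (Set.Ioo 0 T)) ≤
          ENNReal.ofReal Λ *
            (eLpNorm (ε k - ε' (k - 1)) 2 (volume.restrict (Set.Ioo 0 T)) +
              eLpNorm (ε' (k - 1) - ε (k - 1)) 2 (volume.restrict (Set.Ioo 0 T))) := by
  obtain ⟨C, hC₀, hC⟩ := hO.exists_norm_le
  set M := ‖mulCLM hμ.memLp‖
  -- The second term of the pointwise bound is constant in time, so integration gives the factor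
  -- `T`.
  set K := 2 * (α * |1 / δ - 1|) + 8 * M ^ 2 * C * T with hK
  have hK₀ : 0 ≤ K := by positivity
  -- The `+ 1` ensures positivity, since `K` vanishes when `δ = 1` and `μ = 0`.
  refine ⟨K * √T + 1, by positivity, ?_⟩
  intro V _ ψ₀ hψ₀ ε ε' ψ χ h k hk ψk χk hψk hχk
  obtain ⟨k, rfl⟩ := Nat.exists_eq_add_of_le' hk
  rw [Nat.add_sub_cancel]
  have hgrad : MemLp (gradJ μ α (ε (k + 1)) ψk χk) ∞ (volume.restrict (Set.Ioo 0 T)) :=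
    (((h.memLp hμ.memLp (k + 1)).1.const_mul α).add
      (hχk.1.memLp_bracket hμ.memLp hψk.1)).const_mul (-2)
  refine ⟨hgrad.mono_exponent le_top, ?_⟩
  have hm₁ : MemLp (ε (k + 1) - ε' k) ∞ (volume.restrict (Set.Ioo 0 T)) :=
    (h.memLp hμ.memLp (k + 1)).1.sub (h.memLp hμ.memLp k).2
  have hm₂ : MemLp (ε' k - ε k) ∞ (volume.restrict (Set.Ioo 0 T)) :=
    (h.memLp hμ.memLp k).2.sub (h.memLp hμ.memLp k).1
  have hpt := h.abs_gradJ_le hT.le hμ.memLp hC₀.le hC hα hδ.1 hψ₀ k hψk hχk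
  have hle₁ := ofReal_integral_abs_le hT.le hm₁
  have hle₂ := ofReal_integral_abs_le hT.le hm₂
  have hi₁ : Integrable (fun t => |ε (k + 1) t - ε' k t|) (volume.restrict (Set.Ioo 0 T)) :=
    (hm₁.integrable le_top).abs
  have hI₁ : 0 ≤ ∫ t in Set.Ioo 0 T, |ε (k + 1) t - ε' k t| := integral_nonneg fun _ => abs_nonneg _
  have hI₂ : 0 ≤ ∫ t in Set.Ioo 0 T, |ε' k t - ε k t| := integral_nonneg fun _ => abs_nonneg _
  simp only [Pi.sub_apply] at hle₁ hle₂
  set I₁ := ∫ t in Set.Ioo 0 T, |ε (k + 1) t - ε' k t| with hI₁def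
  set I₂ := ∫ t in Set.Ioo 0 T, |ε' k t - ε k t|
  have hreal : ∫ t in Set.Ioo 0 T, |gradJ μ α (ε (k + 1)) ψk χk t| ≤ K * (I₁ + I₂) := by
    calc _ ≤ ∫ t in Set.Ioo 0 T, (2 * (α * |1 / δ - 1|) * |ε (k + 1) t - ε' k t| +
          8 * M ^ 2 * C * (I₁ + I₂)) :=
          integral_mono_ae (hgrad.integrable le_top).abs
            ((hi₁.const_mul _).add (integrable_const _)) hpt
      _ = 2 * (α * |1 / δ - 1|) * I₁ + 8 * M ^ 2 * C * T * (I₁ + I₂) := by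
          rw [integral_add (hi₁.const_mul _) (integrable_const _), integral_const_mul, ← hI₁def,
            setIntegral_const, Measure.real, Real.volume_Ioo, sub_zero,
            ENNReal.toReal_ofReal hT.le, smul_eq_mul]
          ring
      _ ≤ 2 * (α * |1 / δ - 1|) * (I₁ + I₂) + 8 * M ^ 2 * C * T * (I₁ + I₂) := by
          gcongr
          linarith
      _ = _ := by rw [hK]; ring
  calc eLpNorm (gradJ μ α (ε (k + 1)) ψk χk) 1 (volume.restrict (Set.Ioo 0 T))
      = ENNReal.ofReal (∫ t in Set.Ioo 0 T, |gradJ μ α (ε (k + 1)) ψk χk t|) := by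
        rw [eLpNorm_one_eq_lintegral_enorm,
          ← ofReal_integral_norm_eq_lintegral_enorm (hgrad.integrable le_top)]
        rfl
    _ ≤ ENNReal.ofReal (K * (I₁ + I₂)) := ENNReal.ofReal_le_ofReal hreal
    _ = ENNReal.ofReal K * (ENNReal.ofReal I₁ + ENNReal.ofReal I₂) := by
        rw [ENNReal.ofReal_mul hK₀, ENNReal.ofReal_add hI₁ hI₂]
    _ ≤ ENNReal.ofReal K * (ENNReal.ofReal (√T) * eLpNorm (ε (k + 1) - ε' k) 2 _ +
          ENNReal.ofReal (√T) * eLpNorm (ε' k - ε k) 2 _) := by gcongr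
    _ = ENNReal.ofReal (K * √T) * (eLpNorm (ε (k + 1) - ε' k) 2 _ + eLpNorm (ε' k - ε k) 2 _) := by
        rw [ENNReal.ofReal_mul hK₀, ← mul_add, mul_assoc]
    _ ≤ _ := by gcongr; linarith
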